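/- **Theorem 1.5.** A rooted forest on $[n]=\{1,\dots,n\}$ is an unordered (non-planar) forest with vertices labeled bijectively by $[n]$ in which each connected component has a distinguished root. It *avoids* a set $S$ of patterns (permutations $\pi=\pi(1)\cdots\pi(k)$ of $[k]$) if for no $\pi\in S$ there are vertices $v_1,\dots,v_k$, with $v_i$ an ancestor of $v_{i+1}$ for $1\le i<k$, whose labels are in the same relative order as $\pi(1),\dots,\pi(k)$. Two sets $S,S'$ of patterns are *forest-Wilf equivalent* if for every $n\ge 0$ the number of rooted forests on $[n]$ avoiding $S$ equals the number of rooted forests on $[n]$ avoiding $S'$. Let $k\ge 3$ and let $\pi=\pi(1)\cdots\pi(k)$ be a permutation of $[k]$ with $$\pi(k)=\pi(k-1)+1=\pi(k-2)+2,$$ and let $\widetilde\pi=\pi(1)\cdots\pi(k-2)\,\pi(k)\,\pi(k-1)$ be the pattern obtained from $\pi$ by switching its last two entries. Then $\{213,\pi\}$ and $\{213,\widetilde\pi\}$ are forest-Wilf equivalent. -/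

import Mathlib

/-- A rooted labeled forest whose vertices are identified with their labels, the elements of `V`.
It is given by its parent function: `parent v = none` when `v` is a root, and `parent v = some u`
when `u` is the parent of `v`.  Well-foundedness says that following parents upwards from any
vertex ends at a root (no cycles).  No order is kept on the children of a vertex. -/
structure RootedForest (V : Type*) where
  parent : V → Option V
  wf : WellFounded (fun u v : V => parent v = some u)

/-- The vertices on the path from the root to `v` (including `v`) are the ancestors of `v`. -/
def RootedForest.IsAncestor {V : Type*} (F : RootedForest V) (u v : V) : Prop :=
  Relation.ReflTransGen (fun a b : V => F.parent b = some a) u v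

theorem RootedForest.parent_injective {V : Type*} :
    Function.Injective (RootedForest.parent : RootedForest V → V → Option V) := by
  rintro ⟨p, hp⟩ ⟨q, hq⟩ h
  cases h
  rfl

instance RootedForest.instFinite {V : Type*} [Finite V] : Finite (RootedForest V) :=
  Finite.of_injective _ RootedForest.parent_injective

/-- A pattern: a permutation of `{1, …, k}` for some length `k`, shifted to `{0, …, k - 1}`. -/
abbrev Pattern : Type := Σ k : ℕ, Equiv.Perm (Fin k)

/-- An instance of `π` in `F`: vertices `v 0, …, v (k - 1)`, each an ancestor of the next, whose
labels are in the same relative order as `π`. -/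
def RootedForest.IsInstance {V : Type*} [LinearOrder V] (F : RootedForest V) {k : ℕ}
    (π : Equiv.Perm (Fin k)) (v : Fin k → V) : Prop :=
  (∀ i j : Fin k, (i : ℕ) + 1 = (j : ℕ) → F.IsAncestor (v i) (v j)) ∧
    ∀ i j : Fin k, v i < v j ↔ π i < π j

/-- `F` contains the pattern `p`. -/
def RootedForest.Contains {V : Type*} [LinearOrder V] (F : RootedForest V) (p : Pattern) : Prop :=
  ∃ v : Fin p.1 → V, F.IsInstance p.2 v

/-- `F` avoids the set of patterns `S`. -/
def RootedForest.Avoids {V : Type*} [LinearOrder V] (F : RootedForest V) (S : Set Pattern) : Prop :=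
  ∀ p ∈ S, ¬ F.Contains p

/-- The number of rooted labeled forests on `n` labels that avoid `S`. -/
noncomputable def forestCount (S : Set Pattern) (n : ℕ) : ℕ :=
  Nat.card {F : RootedForest (Fin n) // F.Avoids S}

/-- Forest-Wilf equivalence of two sets of patterns. -/
def ForestWilfEquiv (S S' : Set Pattern) : Prop :=
  ∀ n : ℕ, forestCount S n = forestCount S' n

/-- The pattern `213`. -/
def pattern213 : Pattern := ⟨3, Equiv.swap 0 1⟩

/-- The twist of a pattern of length `k ≥ 2`: its last two entries are switched. -/
def twist {k : ℕ} (hk : 2 ≤ k) (π : Equiv.Perm (Fin k)) : Equiv.Perm (Fin k) :=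
  π * Equiv.swap ⟨k - 2, by omega⟩ ⟨k - 1, by omega⟩

/-! Let s be π without its last two entries. If w is a descendant, with a larger label, of a vertex
u ending an instance of s, then avoidance of 213 makes w compare with the earlier entries as u does
(`Occurs.lt_iff_of_above`). The last three values of π being consecutive, a 213-avoiding forest
avoids π exactly when, for every such end u, labels decrease along paths among the larger
descendants of u; it avoids the twist exactly when they increase
(`exists_occurs_iff_exists_sameBlock`). Being above a common end generates blocks, and reversing the
labels inside each block exchanges the two conditions (`flipEquiv`).

For this to be an involution, the blocks must survive it. Vertices of different blocks on one path
keep their relative order (`SameBlock.lt_iff_lt`), and every end has an instance whose earlier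
entries are above no end (`Ends.exists_occurs_not_above`), so the flip carries that instance to an
instance. This last fact is the hard one: it rests on the exchange `Occurs.exists_merge` and uses
that s avoids 213. If s contains 213, both avoidance conditions reduce to avoiding 213. -/

namespace RootedForest

/-- `u` is an ancestor of `v` different from `v`. -/
def StrictAncestor {V : Type*} (F : RootedForest V) (u v : V) : Prop :=
  Relation.TransGen (fun a b : V => F.parent b = some a) u v

/-! ### Ancestors. -/

section Ancestors

variable {V : Type*} {F : RootedForest V} {u v w : V}

theorem StrictAncestor.trans (h : F.StrictAncestor u v) (h' : F.StrictAncestor v w) :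
    F.StrictAncestor u w :=
  Relation.TransGen.trans h h'

theorem wellFounded_strictAncestor (F : RootedForest V) : WellFounded F.StrictAncestor :=
  F.wf.transGen

theorem StrictAncestor.ne (h : F.StrictAncestor u v) : u ≠ v := by
  rintro rfl
  exact (F.wellFounded_strictAncestor.irrefl).irrefl u h

theorem isAncestor_iff : F.IsAncestor u v ↔ u = v ∨ F.StrictAncestor u v := by
  unfold IsAncestor StrictAncestor
  rw [Relation.reflTransGen_iff_eq_or_transGen, eq_comm]

/-- Parents are unique, so the ancestors of a vertex form a chain. -/
theorem StrictAncestor.trichotomy (hu : F.StrictAncestor u w) (hv : F.StrictAncestor v w) :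
    u = v ∨ F.StrictAncestor u v ∨ F.StrictAncestor v u := by
  have hun : Relator.RightUnique (Function.swap fun a b : V => F.parent b = some a) := by
    intro a b c hb hc
    simp only [Function.swap] at hb hc
    exact Option.some.inj (hb.symm.trans hc)
  have hu' := Relation.reflTransGen_swap.2 hu.to_reflTransGen
  have hv' := Relation.reflTransGen_swap.2 hv.to_reflTransGen
  rcases Relation.ReflTransGen.total_of_right_unique hun hu' hv' with h | h
  · rcases isAncestor_iff.1 (Relation.reflTransGen_swap.1 h : F.IsAncestor v u) with h | h
    · exact .inl h.symm
    · exact .inr (.inr h)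
  · rcases isAncestor_iff.1 (Relation.reflTransGen_swap.1 h : F.IsAncestor u v) with h | h
    · exact .inl h
    · exact .inr (.inl h)

end Ancestors

/-! ### Ends of instances and the blocks above them. -/

/-- `F` avoids the pattern `213`. -/
def Avoids213 {V : Type*} [LinearOrder V] (F : RootedForest V) : Prop :=
  ∀ x y z, F.StrictAncestor x y → F.StrictAncestor y z → y < x → ¬ x < z

/-- The values `s 0, …, s L` are distinct and avoid `213`. -/
def WordAvoids213 (s : ℕ → ℕ) (L : ℕ) : Prop :=
  (∀ p q, p < q → q ≤ L → s p ≠ s q) ∧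
    ∀ p q t, p < q → q < t → t ≤ L → s q < s p → ¬ s p < s t

/-- The vertices `f 0, …, f L` form an instance of the word `s 0, …, s L`. -/
def Occurs {V : Type*} [LinearOrder V] (F : RootedForest V) (s : ℕ → ℕ) (L : ℕ) (f : ℕ → V) :
    Prop :=
  ∀ p q, p < q → q ≤ L → F.StrictAncestor (f p) (f q) ∧ (f p < f q ↔ s p < s q)

/-- `v` is the last vertex of an instance of the word `s 0, …, s L`. -/
def Ends {V : Type*} [LinearOrder V] (F : RootedForest V) (s : ℕ → ℕ) (L : ℕ) (v : V) : Prop :=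
  ∃ f, F.Occurs s L f ∧ f L = v

/-- `u` ends an instance of `s` and `x` is a descendant of `u` with a larger label. -/
def Above {V : Type*} [LinearOrder V] (F : RootedForest V) (s : ℕ → ℕ) (L : ℕ) (u x : V) : Prop :=
  F.Ends s L u ∧ F.StrictAncestor u x ∧ u < x

/-- `x` and `y` lie in the same block: they are equal, or both are above the same end. -/
def SameBlock {V : Type*} [LinearOrder V] (F : RootedForest V) (s : ℕ → ℕ) (L : ℕ) (x y : V) :
    Prop :=
  x = y ∨ ∃ u, F.Above s L u x ∧ F.Above s L u y

section Blocks

variable {V : Type*} [LinearOrder V] {F : RootedForest V} {s : ℕ → ℕ} {L : ℕ}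

/-- A label `f p` between `f L` and `w` would make `f p`, `f L`, `w` a 213. -/
theorem Occurs.lt_iff_of_above {f : ℕ → V} (hF : F.Avoids213) (hf : F.Occurs s L f) {w : V}
    (hw : F.StrictAncestor (f L) w) (hlt : f L < w) {p : ℕ} (hp : p < L) :
    f p < w ↔ s p < s L := by
  obtain ⟨hA, ho⟩ := hf p L hp le_rfl
  rw [← ho]
  refine ⟨fun h => ?_, fun h => h.trans hlt⟩
  by_contra hn
  exact hF _ _ _ hA hw (lt_of_le_of_ne (not_lt.1 hn) hA.ne.symm) h

/-! ### Instances whose earlier entries avoid the nontrivial blocks. -/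

/-- An instance `f` with an entry `f i` above an end `u` can be merged with an instance `g` ending
at `u` so that the `i`-th entry is replaced. -/
theorem Occurs.exists_merge {f g : ℕ → V} (hF : F.Avoids213) (hs : WordAvoids213 s L)
    (hf : F.Occurs s L f) (hg : F.Occurs s L g) {i : ℕ} (hi : i < L)
    (hgi : F.StrictAncestor (g L) (f i)) (hlt : g L < f i) (hL : f L < g L) :
    ∃ h : ℕ → V, F.Occurs s L h ∧ h L = f L ∧ h i = g i ∧
      ∀ p, h p = f p ∨ h p = g p := by
  classical
  obtain ⟨hinj, h213⟩ := hs
  -- An entry smaller than `s L` is smaller than everything after it; otherwise `p`, `q`, `L` is a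
  -- 213 in `s`.
  have small : ∀ p q, p < q → q ≤ L → s p < s L → s p < s q := by
    intro p q hpq hq hp
    rcases hq.eq_or_lt with rfl | hq
    · exact hp
    · by_contra hn
      exact h213 p q L hpq hq le_rfl
        (lt_of_le_of_ne (not_lt.1 hn) (hinj p q hpq hq.le).symm) hp
  have hsi : s L < s i := by
    have h1 := (hf i L hi le_rfl).2
    have h2 := hinj i L hi le_rfl
    have h3 : ¬ f i < f L := (hL.trans hlt).not_gt
    rw [h1] at h3
    omega
  -- `N` is the first position after `i` whose entry is at most `s L`; the new instance follows `f`
  -- from `N` on.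
  have hex : ∃ N, i < N ∧ N ≤ L ∧ s N ≤ s L := ⟨L, hi, le_rfl, le_rfl⟩
  obtain ⟨N, ⟨hiN, hNL, hsN⟩, hmin⟩ :
      ∃ N, (i < N ∧ N ≤ L ∧ s N ≤ s L) ∧ ∀ p, p < N → ¬ (i < p ∧ p ≤ L ∧ s p ≤ s L) :=
    ⟨Nat.find hex, Nat.find_spec hex, fun p hp => Nat.find_min hex hp⟩
  have hfN : f N < g L := by
    rcases hNL.eq_or_lt with rfl | hN
    · exact hL
    · have := hinj N L hN le_rfl
      exact ((hf N L hN le_rfl).2.2 (by omega)).trans hL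
  -- Otherwise `g L`, `f N`, `f q` would be a 213.
  have hlow : ∀ q, N ≤ q → q ≤ L → f q < g L := by
    intro q hNq hq
    rcases hNq.eq_or_lt with rfl | hNq
    · exact hfN
    · have hN := hgi.trans (hf i N hiN hNL).1
      have hq' := (hf N q hNq hq).1
      exact lt_of_le_of_ne (not_lt.1 (hF _ _ _ hN hq' hfN)) (hN.trans hq').ne.symm
  have hanc : ∀ p q, p < N → N ≤ q → q ≤ L → F.StrictAncestor (g p) (f q) := fun p q hp hNq hq =>
    ((hg p L (by omega) le_rfl).1.trans hgi).trans (hf i q (by omega) hq).1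
  -- The label `g L` separates the two parts: large entries of `g` exceed it, and `f` from `N` on
  -- stays below it.
  have cross : ∀ p q, p < N → s L < s p → N ≤ q → q ≤ L →
      F.StrictAncestor (g p) (f q) ∧ (g p < f q ↔ s p < s q) := by
    intro p q hp hsp hNq hq
    refine ⟨hanc p q hp hNq hq, iff_of_false ?_ ?_⟩
    · have h1 := (hg p L (by omega) le_rfl)
      have h2 : ¬ g p < g L := by rw [h1.2]; omega
      exact not_lt.2 ((hlow q hNq hq).le.trans (not_lt.1 h2))
    · rcases hNq.eq_or_lt with rfl | hNq
      · omega
      · exact h213 p N q hp hNq hq (by omega)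
  have large : ∀ p, i ≤ p → p < N → s L < s p := by
    intro p hip hp
    rcases hip.eq_or_lt with rfl | hip
    · exact hsi
    · by_contra hn
      exact hmin p hp ⟨hip, by omega, not_lt.1 hn⟩
  -- `J` is the last position before `i` with entry below `s L`. If `f J ≤ g J`, then `f J` is `g J`
  -- or an ancestor of it, and `g` replaces `f` only strictly between `J` and `N`. Otherwise `g`
  -- replaces `f` everywhere before `N`: its small entries are at most `g J < f J`, hence below the
  -- rest of `f`.
  by_cases hA : ∃ J, J < i ∧ s J < s L ∧ (∀ p, J < p → p < i → s L < s p) ∧ f J ≤ g J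
  · obtain ⟨J, hJi, hsJ, hJ, hle⟩ := hA
    have hlarge : ∀ p, J < p → p < N → s L < s p := fun p h1 h2 =>
      (lt_or_ge p i).elim (hJ p h1) fun h => large p h h2
    have hJv : f J < f L := (hf J L (by omega) le_rfl).2.2 hsJ
    have hfJi := (hf J i hJi hi.le).1
    have hgJ := hg J L (by omega) le_rfl
    have hfJu : F.StrictAncestor (f J) (g L) := by
      rcases hfJi.trichotomy hgi with h | h | h
      · exact absurd h (hJv.trans hL).ne
      · exact h
      · exact absurd hlt (hF _ _ _ h hfJi (hJv.trans hL))
    have hfg : f J = g J ∨ F.StrictAncestor (f J) (g J) := by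
      rcases hfJu.trichotomy hgJ.1 with h | h | h
      · exact .inl h
      · exact .inr h
      · exact absurd (hgJ.2.2 hsJ) (hF _ _ _ h hfJu (lt_of_le_of_ne hle h.ne.symm))
    refine ⟨fun p => if J < p ∧ p < N then g p else f p, ?_, by simp [hNL.not_gt], by simp [hJi, hiN],
      fun p => by dsimp only; split_ifs <;> simp⟩
    intro p q hpq hq
    by_cases hp : J < p ∧ p < N <;> by_cases hq' : J < q ∧ q < N
    · simpa only [if_pos hp, if_pos hq'] using hg p q hpq hq
    · simpa only [if_pos hp, if_neg hq'] using
        cross p q hp.2 (hlarge p hp.1 hp.2) (by omega) hq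
    · simp only [if_neg hp, if_pos hq']
      have hpJ : p ≤ J := by omega
      have hsq := hlarge q hq'.1 hq'.2
      have hJq : F.StrictAncestor (f J) (g q) := by
        have := (hg J q hq'.1 hq).1
        rcases hfg with h | h
        · rwa [h]
        · exact h.trans this
      have hpq' : F.StrictAncestor (f p) (g q) := by
        rcases hpJ.eq_or_lt with rfl | h
        · exact hJq
        · exact (hf p J h (by omega)).1.trans hJq
      refine ⟨hpq', ?_⟩
      have hpL : p < L := by omega
      rcases lt_or_gt_of_ne (hinj p L hpL le_rfl) with hsp | hsp
      · refine iff_of_true ?_ (by omega)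
        have h1 := (hf p L hpL le_rfl).2.2 hsp
        have h2 : ¬ g q < g L := by rw [(hg q L (by omega) le_rfl).2]; omega
        exact (h1.trans hL).trans_le (not_lt.1 h2)
      · have hpJ' : p < J := lt_of_le_of_ne hpJ (by rintro rfl; omega)
        refine iff_of_false ?_ (h213 p J q hpJ' hq'.1 hq (by omega))
        obtain ⟨h1, h2⟩ := hf p J hpJ' (by omega)
        have h3 : ¬ f p < f J := by rw [h2]; omega
        exact hF _ _ _ h1 hJq (lt_of_le_of_ne (not_lt.1 h3) h1.ne.symm)
    · simpa only [if_neg hp, if_neg hq'] using hf p q hpq hq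
  · have hB : ∀ p q, p < N → s p < s L → N ≤ q → q ≤ L → g p < f q := by
      intro p q hp hsp hNq hq
      have hpi : p < i := by
        by_contra h
        exact absurd (large p (not_lt.1 h) hp) (by omega)
      let J := Nat.findGreatest (fun j => s j < s L) (i - 1)
      have hJi : J ≤ i - 1 := Nat.findGreatest_le _
      have hsJ : s J < s L :=
        Nat.findGreatest_spec (P := fun j => s j < s L) (m := p) (by omega) hsp
      have hpJ : p ≤ J := Nat.le_findGreatest (P := fun j => s j < s L) (by omega) hsp
      have hJ : ∀ t, J < t → t < i → s L < s t := by
        intro t h1 h2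
        have h3 := Nat.findGreatest_is_greatest (P := fun j => s j < s L) h1 (by omega)
        have h4 := hinj t L (by omega) le_rfl
        omega
      have hgf : g J < f J := not_le.1 fun h => hA ⟨J, by omega, hsJ, hJ, h⟩
      have h1 : f J < f q := (hf J q (by omega) hq).2.2 (small J q (by omega) hq hsJ)
      have h2 : g p ≤ g J := by
        rcases hpJ.eq_or_lt with h | h
        · rw [← h]
        · exact ((hg p J h (by omega)).2.2 (small p J h (by omega) hsp)).le
      exact h2.trans_lt (hgf.trans h1)
    refine ⟨fun p => if p < N then g p else f p, ?_, by simp [hNL.not_gt], by simp [hiN],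
      fun p => by dsimp only; split_ifs <;> simp⟩
    intro p q hpq hq
    by_cases hp : p < N <;> by_cases hq' : q < N
    · simpa only [if_pos hp, if_pos hq'] using hg p q hpq hq
    · simp only [if_pos hp, if_neg hq']
      rcases lt_or_gt_of_ne (hinj p L (by omega) le_rfl) with hsp | hsp
      · exact ⟨hanc p q hp (not_lt.1 hq') hq, iff_of_true (hB p q hp hsp (not_lt.1 hq') hq)
          (small p q hpq hq hsp)⟩
      · exact cross p q hp hsp (not_lt.1 hq') hq
    · omega
    · simpa only [if_neg hp, if_neg hq'] using hf p q hpq hq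

/-- Every end is the end of an instance none of whose other entries is above an end. -/
theorem Ends.exists_occurs_not_above (hF : F.Avoids213) (hs : WordAvoids213 s L) {v : V}
    (hv : F.Ends s L v) :
    ∃ f, F.Occurs s L f ∧ f L = v ∧ ∀ p < L, ∀ u, ¬ F.Above s L u (f p) := by
  classical
  induction v using F.wellFounded_strictAncestor.induction with
  | _ v ih =>
  -- If `v` is above an end `u`, a good instance for `u` becomes one for `v` by changing only its
  -- last entry.
  by_cases hT : ∃ u, F.Above s L u v
  · obtain ⟨u, hu, huv, hlt⟩ := hT
    obtain ⟨f, hf, rfl, hfT⟩ := ih u huv hu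
    refine ⟨fun p => if p = L then v else f p, ?_, by simp, fun p hp => by
      simpa only [if_neg hp.ne] using hfT p hp⟩
    intro p q hpq hq
    have hp : p < L := hpq.trans_le hq
    rcases hq.eq_or_lt with rfl | hq
    · simpa only [if_neg hp.ne, if_true] using
        ⟨(hf p q hpq le_rfl).1.trans huv, hf.lt_iff_of_above hF huv hlt hpq⟩
    · simpa only [if_neg hp.ne, if_neg hq.ne] using hf p q hpq hq.le
  · obtain ⟨f, hf, hfv⟩ := hv
    -- Induction on the number of bad entries: merging with a good instance for `u` repairs entry
    -- `i` and, since the entries of `g` before `L` are good, spoils no other.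
    induction hn : ((Finset.range L).filter fun p => ∃ u, F.Above s L u (f p)).card
      using Nat.strong_induction_on generalizing f with
    | _ n ihn =>
    by_cases hgood : ∀ p < L, ∀ u, ¬ F.Above s L u (f p)
    · exact ⟨f, hf, hfv, hgood⟩
    · push Not at hgood
      obtain ⟨i, hi, u, hu⟩ := hgood
      have huv : F.StrictAncestor u v := hu.2.1.trans (hfv ▸ (hf i L hi le_rfl).1)
      have hvu : v < u :=
        lt_of_le_of_ne (not_lt.1 fun h => hT ⟨u, hu.1, huv, h⟩) huv.ne.symm
      obtain ⟨g, hg, rfl, hgT⟩ := ih u huv hu.1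
      obtain ⟨h, hh, hhL, hhi, hfg⟩ :=
        hf.exists_merge hF hs hg hi hu.2.1 hu.2.2 (hfv ▸ hvu)
      refine ihn _ ?_ h hh (hhL.trans hfv) rfl
      rw [← hn]
      refine Finset.card_lt_card (Finset.ssubset_iff_of_subset ?_ |>.2 ⟨i, ?_, ?_⟩)
      · intro p hp
        simp only [Finset.mem_filter, Finset.mem_range] at hp ⊢
        refine ⟨hp.1, ?_⟩
        rcases hfg p with h' | h'
        · exact h' ▸ hp.2
        · obtain ⟨hp, w, hw⟩ := hp
          exact absurd (h' ▸ hw) (hgT p hp w)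
      · simp only [Finset.mem_filter, Finset.mem_range]
        exact ⟨hi, _, hu⟩
      · simp only [Finset.mem_filter, Finset.mem_range, hhi]
        rintro ⟨_, w, hw⟩
        exact hgT i hi w hw

/-! ### Blocks as equivalence classes, and the order between them. -/

theorem Above.trans {u v x : V} (h : F.Above s L u v) (h' : F.Above s L v x) : F.Above s L u x :=
  ⟨h.1, h.2.1.trans h'.2.1, h.2.2.trans h'.2.2⟩

/-- A topmost end `t` is above no end, hence outside the block it governs, so its comparisons with
that block survive the flip. -/
theorem Above.exists_top {u x : V} (h : F.Above s L u x) :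
    ∃ t, F.Above s L t x ∧ (t = u ∨ F.Above s L t u) ∧ ∀ w, ¬ F.Above s L w t := by
  induction u using F.wellFounded_strictAncestor.induction with
  | _ u ih =>
  by_cases hT : ∃ w, F.Above s L w u
  · obtain ⟨w, hw⟩ := hT
    obtain ⟨t, ht, htw, htop⟩ := ih w hw.2.1 (hw.trans h)
    refine ⟨t, ht, .inr ?_, htop⟩
    rcases htw with rfl | htw
    · exact hw
    · exact htw.trans hw
  · exact ⟨u, h, .inl rfl, not_exists.1 hT⟩

/-- If the lower of two ends over `x` had the smaller label, the two ends and `x` would form a 213.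
So ends over `x` are nested, which gives transitivity of blocks. -/
theorem Above.comparable (hF : F.Avoids213) {u v x : V} (hu : F.Above s L u x)
    (hv : F.Above s L v x) : u = v ∨ F.Above s L u v ∨ F.Above s L v u := by
  have key : ∀ {u v : V}, F.Above s L u x → F.Above s L v x → F.StrictAncestor u v →
      F.Above s L u v := fun hu hv h =>
    ⟨hu.1, h, lt_of_le_of_ne (not_lt.1 fun hlt => hF _ _ _ h hv.2.1 hlt hu.2.2) h.ne⟩
  rcases hu.2.1.trichotomy hv.2.1 with h | h | h
  · exact .inl h
  · exact .inr (.inl (key hu hv h))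
  · exact .inr (.inr (key hv hu h))

theorem SameBlock.symm {x y : V} (h : F.SameBlock s L x y) : F.SameBlock s L y x := by
  rcases h with rfl | ⟨u, hx, hy⟩
  · exact .inl rfl
  · exact .inr ⟨u, hy, hx⟩

theorem sameBlock_equivalence (hF : F.Avoids213) : Equivalence (F.SameBlock s L) where
  refl _ := .inl rfl
  symm := SameBlock.symm
  trans := by
    rintro x y z (rfl | ⟨u, hx, hy⟩) (rfl | ⟨v, hy', hz⟩)
    · exact .inl rfl
    · exact .inr ⟨v, hy', hz⟩
    · exact .inr ⟨u, hx, hy⟩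
    · rcases hy.comparable hF hy' with rfl | h | h
      · exact .inr ⟨u, hx, hz⟩
      · exact .inr ⟨u, hx, h.trans hz⟩
      · exact .inr ⟨v, h.trans hx, hz⟩

theorem SameBlock.above_left {x y : V} (h : F.SameBlock s L x y) (hne : x ≠ y) :
    ∃ u, F.Above s L u x ∧ F.Above s L u y :=
  h.resolve_left hne

/-- Replacing the lower vertex by another one of its block does not change its comparison with a
vertex outside the block. -/
theorem SameBlock.lt_iff_right (hF : F.Avoids213) {x y y' : V} (hxy : F.StrictAncestor x y)
    (hn : ¬ F.SameBlock s L x y) (hy : F.SameBlock s L y y') : x < y ↔ x < y' := by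
  rcases hy with rfl | ⟨u, hu, hu'⟩
  · exact Iff.rfl
  rcases hxy.trichotomy hu.2.1 with rfl | h | h
  · exact iff_of_true hu.2.2 hu'.2.2
  · rcases lt_or_gt_of_ne h.ne with hlt | hlt
    · exact iff_of_true (hlt.trans hu.2.2) (hlt.trans hu'.2.2)
    · exact iff_of_false (hF _ _ _ h hu.2.1 hlt) (hF _ _ _ h hu'.2.1 hlt)
  · have hlt : x < u := lt_of_le_of_ne
      (not_lt.1 fun hlt => hn (.inr ⟨u, ⟨hu.1, h, hlt⟩, hu⟩)) h.ne.symm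
    exact iff_of_true (hlt.trans hu.2.2) (hlt.trans hu'.2.2)

/-- If `x` is above an end `u`, then `y` cannot exceed `u` without joining its block. This persists
for `y'`, so both `y` and `y'` lie below all labels above `u`. -/
theorem SameBlock.lt_iff_lt (hF : F.Avoids213) {x y x' y' : V} (hxy : F.StrictAncestor x y)
    (hn : ¬ F.SameBlock s L x y) (hx : F.SameBlock s L x x') (hy : F.SameBlock s L y y') :
    x < y ↔ x' < y' := by
  rw [SameBlock.lt_iff_right hF hxy hn hy]
  rcases hx with rfl | ⟨u, hu, hu'⟩
  · exact Iff.rfl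
  have huy := hu.2.1.trans hxy
  have hyu : ¬ u < y := fun hlt => hn (.inr ⟨u, hu, hu.1, huy, hlt⟩)
  have hun : ¬ F.SameBlock s L u y := by
    intro h
    obtain ⟨w, hwu, hwy⟩ := h.above_left huy.ne
    exact hn (.inr ⟨w, hwu.trans hu, hwy⟩)
  rw [SameBlock.lt_iff_right hF huy hun hy] at hyu
  exact iff_of_false (not_lt.2 ((not_lt.1 hyu).trans hu.2.2.le))
    (not_lt.2 ((not_lt.1 hyu).trans hu'.2.2.le))

theorem Above.not_sameBlock_of_top {t x : V} (h : F.Above s L t x)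
    (ht : ∀ w, ¬ F.Above s L w t) : ¬ F.SameBlock s L t x := fun hb => by
  obtain ⟨w, hw, _⟩ := hb.above_left h.2.1.ne
  exact ht w hw

end Blocks

/-! ### Relabeling a forest. -/

section Relabel

/-- Relabeling the vertices of a forest. -/
def relabel {V : Type*} (F : RootedForest V) (θ : Equiv.Perm V) : RootedForest V where
  parent v := (F.parent (θ.symm v)).map θ
  wf := by
    refine Subrelation.wf (fun {a b} h => ?_) (InvImage.wf θ.symm F.wf)
    obtain ⟨c, hc, rfl⟩ := Option.map_eq_some_iff.1 h
    simpa [InvImage] using hc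

theorem strictAncestor_relabel {V : Type*} {F : RootedForest V} {θ : Equiv.Perm V} {x y : V} :
    (F.relabel θ).StrictAncestor (θ x) (θ y) ↔ F.StrictAncestor x y := by
  constructor
  · intro h
    have := Relation.TransGen.lift (p := fun a b : V => F.parent b = some a) θ.symm
      (fun a b h => by
        obtain ⟨c, hc, rfl⟩ := Option.map_eq_some_iff.1 h
        simpa [Function.onFun] using hc) _ _ h
    simpa [Function.onFun, StrictAncestor] using this
  · exact fun h => Relation.TransGen.lift θ (fun a b h => by
      change Option.map θ (F.parent (θ.symm (θ b))) = some (θ a)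
      rw [Equiv.symm_apply_apply, h, Option.map_some]) _ _ h

theorem relabel_relabel {V : Type*} (F : RootedForest V) (θ : Equiv.Perm V)
    (hθ : ∀ x, θ (θ x) = x) : (F.relabel θ).relabel θ = F := by
  apply parent_injective
  funext v
  have h : ∀ x, θ.symm x = θ x := fun x => by rw [Equiv.symm_apply_eq, hθ]
  change Option.map θ (Option.map θ (F.parent (θ.symm (θ.symm v)))) = _
  rw [h, h, hθ, Option.map_map, show (θ ∘ θ : V → V) = id from funext hθ, Option.map_id, id]

end Relabel

end RootedForest

/-! ### Order reversal within the classes of an equivalence relation. -/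

/-- `θ` reverses the order within each class of `r`, and maps each class to itself. -/
structure IsBlockReversal {V : Type*} [LinearOrder V] (r : V → V → Prop) (θ : Equiv.Perm V) :
    Prop where
  involutive : ∀ x, θ (θ x) = x
  rel : ∀ x, r x (θ x)
  lt_iff : ∀ x y, r x y → (θ x < θ y ↔ y < x)

theorem Finset.exists_order_reversal {V : Type*} [LinearOrder V] (c : Finset V) :
    ∃ g : V → V, ∀ x ∈ c, g x ∈ c ∧ g (g x) = x ∧ ∀ y ∈ c, (g x < g y ↔ y < x) := by
  let e := c.orderIsoOfFin rfl
  refine ⟨fun x => if h : x ∈ c then (e (Fin.rev (e.symm ⟨x, h⟩)) : V) else x, fun x hx => ?_⟩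
  refine ⟨by simp [hx], by simp [hx], fun y hy => ?_⟩
  simp [hx, hy]

theorem exists_isBlockReversal {V : Type*} [LinearOrder V] [Fintype V] {r : V → V → Prop}
    (hr : Equivalence r) : ∃ θ : Equiv.Perm V, IsBlockReversal r θ := by
  classical
  choose g hg using fun c : Finset V => c.exists_order_reversal
  let c : V → Finset V := fun x => Finset.univ.filter (r x)
  have hmem : ∀ x y, y ∈ c x ↔ r x y := fun x y => by simp [c]
  have hc : ∀ x y, r x y → c y = c x := fun x y h => by
    ext z
    rw [hmem, hmem]
    exact ⟨hr.trans h, hr.trans (hr.symm h)⟩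
  have hself : ∀ x, x ∈ c x := fun x => (hmem x x).2 (hr.refl x)
  have hrel : ∀ x, r x (g (c x) x) := fun x => (hmem _ _).1 (hg (c x) x (hself x)).1
  have hinv : Function.Involutive fun x => g (c x) x := fun x => by
    dsimp only
    rw [hc _ _ (hrel x)]
    exact (hg (c x) x (hself x)).2.1
  refine ⟨hinv.toPerm, hinv, hrel, fun x y h => ?_⟩
  change g (c x) x < g (c y) y ↔ _
  rw [hc x y h]
  exact (hg (c x) x (hself x)).2.2 y ((hmem _ _).2 h)

/-! ### The flip and its invariants. -/

namespace RootedForest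

section Flip

variable {V : Type*} [LinearOrder V]

/-- Labels increase along every path inside a block. -/
def BlocksIncrease (F : RootedForest V) (s : ℕ → ℕ) (L : ℕ) : Prop :=
  ∀ x y, F.StrictAncestor x y → F.SameBlock s L x y → x < y

/-- Labels decrease along every path inside a block. -/
def BlocksDecrease (F : RootedForest V) (s : ℕ → ℕ) (L : ℕ) : Prop :=
  ∀ x y, F.StrictAncestor x y → F.SameBlock s L x y → y < x

variable {F : RootedForest V} {s : ℕ → ℕ} {L : ℕ} {θ : Equiv.Perm V}

theorem relabel_lt_iff (hF : F.Avoids213) (hθ : IsBlockReversal (F.SameBlock s L) θ) {x y : V}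
    (h : F.StrictAncestor x y) (hn : ¬ F.SameBlock s L x y) : θ x < θ y ↔ x < y :=
  (SameBlock.lt_iff_lt hF h hn (hθ.rel x) (hθ.rel y)).symm

/-- A 213 created inside one block would come from a 231 there, which monotone blocks exclude. In
the mixed cases an end over `x` would also be under `y` or `z`, merging blocks assumed distinct. -/
theorem avoids213_relabel (hF : F.Avoids213) (hθ : IsBlockReversal (F.SameBlock s L) θ)
    (hmono : F.BlocksIncrease s L ∨ F.BlocksDecrease s L) : (F.relabel θ).Avoids213 := by
  have hE := F.sameBlock_equivalence (s := s) (L := L) hF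
  intro x y z hxy hyz
  obtain ⟨x, rfl⟩ := θ.surjective x
  obtain ⟨y, rfl⟩ := θ.surjective y
  obtain ⟨z, rfl⟩ := θ.surjective z
  rw [strictAncestor_relabel] at hxy hyz
  have hxz := hxy.trans hyz
  intro h1 h2
  by_cases bxy : F.SameBlock s L x y
  · rw [hθ.lt_iff _ _ (hE.symm bxy)] at h1
    by_cases bxz : F.SameBlock s L x z
    · rw [hθ.lt_iff _ _ bxz] at h2
      rcases hmono with h | h
      · exact (h _ _ hxz bxz).not_gt h2
      · exact (h _ _ hxy bxy).not_gt h1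
    · rw [relabel_lt_iff hF hθ hxz bxz] at h2
      obtain ⟨u, hu, _⟩ := bxy.above_left hxy.ne
      exact bxz (.inr ⟨u, hu, hu.1, hu.2.1.trans hxz, hu.2.2.trans h2⟩)
  · have h1' : y < x := by
      have := (relabel_lt_iff hF hθ hxy bxy).not.1 h1.not_gt
      exact lt_of_le_of_ne (not_lt.1 this) hxy.ne.symm
    have bxz : ¬ F.SameBlock s L x z := by
      intro bxz
      obtain ⟨u, hu, huz⟩ := bxz.above_left hxz.ne
      have huy := hu.2.1.trans hxy
      have : u < y := lt_of_le_of_ne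
        (not_lt.1 fun hlt => hF _ _ _ huy hyz hlt huz.2.2) huy.ne
      exact bxy (.inr ⟨u, hu, hu.1, huy, this⟩)
    rw [relabel_lt_iff hF hθ hxz bxz] at h2
    exact hF _ _ _ hxy hyz h1' h2

/-- No two entries share a block, since the earlier one is above no end; so all comparisons are
kept. -/
theorem occurs_relabel_iff (hF : F.Avoids213) (hθ : IsBlockReversal (F.SameBlock s L) θ)
    {f : ℕ → V} (hf : ∀ p < L, ∀ u, ¬ F.Above s L u (f p)) :
    (F.relabel θ).Occurs s L (fun p => θ (f p)) ↔ F.Occurs s L f := by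
  refine forall₄_congr fun p q hpq hq => ?_
  rw [strictAncestor_relabel]
  refine and_congr_right fun h => ?_
  rw [relabel_lt_iff hF hθ h]
  intro hb
  obtain ⟨u, hu, _⟩ := hb.above_left h.ne
  exact hf p (hpq.trans_le hq) u hu

theorem ends_relabel_iff (hF : F.Avoids213) (hs : WordAvoids213 s L)
    (hθ : IsBlockReversal (F.SameBlock s L) θ) (hF' : (F.relabel θ).Avoids213) {v : V} :
    (F.relabel θ).Ends s L (θ v) ↔ F.Ends s L v := by
  have mp : ∀ {v}, F.Ends s L v → (F.relabel θ).Ends s L (θ v) := fun hv => by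
    obtain ⟨f, hf, rfl, hfT⟩ := hv.exists_occurs_not_above hF hs
    exact ⟨fun p => θ (f p), (occurs_relabel_iff hF hθ hfT).2 hf, rfl⟩
  refine ⟨fun hv => ?_, mp⟩
  obtain ⟨f, hf, hfv, hfT⟩ := hv.exists_occurs_not_above hF' hs
  obtain ⟨f, rfl⟩ : ∃ f' : ℕ → V, f = fun p => θ (f' p) :=
    ⟨fun p => θ.symm (f p), by simp⟩
  refine ⟨f, (occurs_relabel_iff hF hθ fun p hp u hu => ?_).1 hf, θ.injective hfv⟩
  -- If `f p` were above an end of `F`, it would be above a topmost one, and that relation persists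
  -- after relabeling.
  obtain ⟨t, ht, -, htop⟩ := hu.exists_top
  exact hfT p hp (θ t) ⟨mp ht.1, strictAncestor_relabel.2 ht.2.1,
    (relabel_lt_iff hF hθ ht.2.1 (ht.not_sameBlock_of_top htop)).2 ht.2.2⟩

theorem sameBlock_relabel_apply_iff (hF : F.Avoids213) (hs : WordAvoids213 s L)
    (hθ : IsBlockReversal (F.SameBlock s L) θ) (hF' : (F.relabel θ).Avoids213) {x y : V} :
    (F.relabel θ).SameBlock s L (θ x) (θ y) ↔ F.SameBlock s L x y := by
  have hE := F.sameBlock_equivalence (s := s) (L := L) hF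
  constructor
  · rintro (h | ⟨u, hx, hy⟩)
    · exact .inl (θ.injective h)
    obtain ⟨u, rfl⟩ := θ.surjective u
    obtain ⟨hu, hux, hltx⟩ := hx
    obtain ⟨-, huy, hlty⟩ := hy
    rw [ends_relabel_iff hF hs hθ hF'] at hu
    rw [strictAncestor_relabel] at hux huy
    have key : ∀ {z}, F.StrictAncestor u z → θ u < θ z →
        F.SameBlock s L u z ∨ F.Above s L u z := fun {z} huz hlt => by
      by_cases hb : F.SameBlock s L u z
      · exact .inl hb
      · exact .inr ⟨hu, huz, (relabel_lt_iff hF hθ huz hb).1 hlt⟩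
    have key' : ∀ {z w}, F.StrictAncestor u z → F.SameBlock s L u z → F.Above s L u w →
        F.SameBlock s L z w := fun {z w} huz hb hw => by
      obtain ⟨t, htu, htz⟩ := hb.above_left huz.ne
      exact .inr ⟨t, htz, htu.trans hw⟩
    rcases key hux hltx with hx | hx <;> rcases key huy hlty with hy | hy
    · exact hE.trans (hE.symm hx) hy
    · exact key' hux hx hy
    · exact hE.symm (key' huy hy hx)
    · exact .inr ⟨u, hx, hy⟩
  · rintro (rfl | ⟨u, hx, hy⟩)
    · exact .inl rfl
    obtain ⟨t, htx, htu, htop⟩ := hx.exists_top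
    have hty : F.Above s L t y := by
      rcases htu with rfl | htu
      · exact hy
      · exact htu.trans hy
    have key : ∀ {z}, F.Above s L t z → (F.relabel θ).Above s L (θ t) (θ z) := fun hz =>
      ⟨(ends_relabel_iff hF hs hθ hF').2 hz.1, strictAncestor_relabel.2 hz.2.1,
        (relabel_lt_iff hF hθ hz.2.1 (hz.not_sameBlock_of_top htop)).2 hz.2.2⟩
    exact .inr ⟨θ t, key htx, key hty⟩

theorem sameBlock_relabel (hF : F.Avoids213) (hs : WordAvoids213 s L)
    (hθ : IsBlockReversal (F.SameBlock s L) θ) (hF' : (F.relabel θ).Avoids213) :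
    (F.relabel θ).SameBlock s L = F.SameBlock s L := by
  have hE := F.sameBlock_equivalence (s := s) (L := L) hF
  funext x y
  have h := sameBlock_relabel_apply_iff hF hs hθ hF' (x := θ x) (y := θ y)
  rw [hθ.involutive, hθ.involutive] at h
  rw [h]
  exact propext ⟨fun h => hE.trans (hθ.rel x) (hE.trans h (hE.symm (hθ.rel y))),
    fun h => hE.trans (hE.symm (hθ.rel x)) (hE.trans h (hθ.rel y))⟩

theorem blocksDecrease_relabel (hF : F.Avoids213) (hs : WordAvoids213 s L)
    (hθ : IsBlockReversal (F.SameBlock s L) θ) (hF' : (F.relabel θ).Avoids213)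
    (h : F.BlocksIncrease s L) : (F.relabel θ).BlocksDecrease s L := by
  intro x y hxy hb
  obtain ⟨x, rfl⟩ := θ.surjective x
  obtain ⟨y, rfl⟩ := θ.surjective y
  rw [strictAncestor_relabel] at hxy
  rw [sameBlock_relabel_apply_iff hF hs hθ hF'] at hb
  exact (hθ.lt_iff _ _ hb.symm).2 (h _ _ hxy hb)

theorem blocksIncrease_relabel (hF : F.Avoids213) (hs : WordAvoids213 s L)
    (hθ : IsBlockReversal (F.SameBlock s L) θ) (hF' : (F.relabel θ).Avoids213)
    (h : F.BlocksDecrease s L) : (F.relabel θ).BlocksIncrease s L := by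
  intro x y hxy hb
  obtain ⟨x, rfl⟩ := θ.surjective x
  obtain ⟨y, rfl⟩ := θ.surjective y
  rw [strictAncestor_relabel] at hxy
  rw [sameBlock_relabel_apply_iff hF hs hθ hF'] at hb
  exact (hθ.lt_iff _ _ hb).2 (h _ _ hxy hb)

open Classical in
/-- A chosen order reversal of the blocks of `F`. -/
noncomputable def blockReversal (r : V → V → Prop) : Equiv.Perm V :=
  if h : ∃ θ : Equiv.Perm V, IsBlockReversal r θ then h.choose else 1

theorem isBlockReversal_blockReversal [Fintype V] {r : V → V → Prop} (hr : Equivalence r) :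
    IsBlockReversal r (blockReversal r) := by
  have h := exists_isBlockReversal hr
  rw [blockReversal, dif_pos h]
  exact h.choose_spec

/-- Reverse the order of the labels within each block. -/
noncomputable def flip (F : RootedForest V) (s : ℕ → ℕ) (L : ℕ) : RootedForest V :=
  F.relabel (blockReversal (F.SameBlock s L))

/-- `blockReversal` depends only on the block relation, which the flip preserves, so the same
involution is applied twice. -/
theorem flip_flip [Fintype V] (hs : WordAvoids213 s L) (hF : F.Avoids213)
    (hF' : (F.flip s L).Avoids213) : (F.flip s L).flip s L = F := by
  have hθ := isBlockReversal_blockReversal (F.sameBlock_equivalence (s := s) (L := L) hF)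
  rw [flip, flip, sameBlock_relabel hF hs hθ hF']
  exact relabel_relabel _ _ hθ.involutive

/-- Flipping exchanges the forests with increasing blocks and those with decreasing blocks. -/
noncomputable def flipEquiv [Fintype V] (hs : WordAvoids213 s L) :
    {F : RootedForest V // F.Avoids213 ∧ F.BlocksDecrease s L} ≃
      {F : RootedForest V // F.Avoids213 ∧ F.BlocksIncrease s L} :=
  have key (F : RootedForest V) (hF : F.Avoids213)
      (h : F.BlocksIncrease s L ∨ F.BlocksDecrease s L) : (F.flip s L).Avoids213 :=
    avoids213_relabel hF (isBlockReversal_blockReversal (F.sameBlock_equivalence hF)) h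
  { toFun F := ⟨F.1.flip s L, key F.1 F.2.1 (.inr F.2.2), blocksIncrease_relabel F.2.1 hs
      (isBlockReversal_blockReversal (F.1.sameBlock_equivalence F.2.1))
      (key F.1 F.2.1 (.inr F.2.2)) F.2.2⟩
    invFun F := ⟨F.1.flip s L, key F.1 F.2.1 (.inl F.2.2), blocksDecrease_relabel F.2.1 hs
      (isBlockReversal_blockReversal (F.1.sameBlock_equivalence F.2.1))
      (key F.1 F.2.1 (.inl F.2.2)) F.2.2⟩
    left_inv F := Subtype.ext (flip_flip hs F.2.1 (key F.1 F.2.1 (.inr F.2.2)))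
    right_inv F := Subtype.ext (flip_flip hs F.2.1 (key F.1 F.2.1 (.inl F.2.2))) }

end Flip
end RootedForest

/-! ### Words of permutations and of their twists. -/

/-- The one-line notation of `π`, as a sequence of natural numbers (extended by `0`). -/
def permWord {k : ℕ} (π : Equiv.Perm (Fin k)) (p : ℕ) : ℕ :=
  if h : p < k then π ⟨p, h⟩ else 0

theorem permWord_of_lt {k : ℕ} (π : Equiv.Perm (Fin k)) {p : ℕ} (h : p < k) :
    permWord π p = π ⟨p, h⟩ :=
  dif_pos h

theorem permWord_ne {k : ℕ} (π : Equiv.Perm (Fin k)) {p q : ℕ} (hp : p < k) (hq : q < k)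
    (h : p ≠ q) : permWord π p ≠ permWord π q := by
  rw [permWord_of_lt π hp, permWord_of_lt π hq, Ne, Fin.val_inj, π.injective.eq_iff, Fin.mk.injEq]
  exact h

theorem permWord_twist_of_lt {k : ℕ} (hk : 2 ≤ k) (π : Equiv.Perm (Fin k)) {p : ℕ}
    (hp : p < k - 2) : permWord (twist hk π) p = permWord π p := by
  have h : p < k := by omega
  rw [permWord_of_lt _ h, permWord_of_lt _ h, twist, Equiv.Perm.mul_apply,
    Equiv.swap_apply_of_ne_of_ne] <;>
  · rw [Ne, Fin.mk.injEq]; omega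

theorem permWord_twist_penultimate {k : ℕ} (hk : 2 ≤ k) (π : Equiv.Perm (Fin k)) :
    permWord (twist hk π) (k - 2) = permWord π (k - 1) := by
  rw [permWord_of_lt _ (show k - 2 < k by omega), permWord_of_lt _ (show k - 1 < k by omega),
    twist, Equiv.Perm.mul_apply, Equiv.swap_apply_left]

theorem permWord_twist_last {k : ℕ} (hk : 2 ≤ k) (π : Equiv.Perm (Fin k)) :
    permWord (twist hk π) (k - 1) = permWord π (k - 2) := by
  rw [permWord_of_lt _ (show k - 2 < k by omega), permWord_of_lt _ (show k - 1 < k by omega),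
    twist, Equiv.Perm.mul_apply, Equiv.swap_apply_right]

/-! ### Pattern containment in terms of words and blocks. -/

namespace RootedForest

variable {V : Type*} [LinearOrder V] {F : RootedForest V} {s : ℕ → ℕ} {L : ℕ}

theorem IsInstance.strictAncestor {k : ℕ} {π : Equiv.Perm (Fin k)} {v : Fin k → V}
    (h : F.IsInstance π v) {i j : Fin k} (hij : i < j) : F.StrictAncestor (v i) (v j) := by
  have step : ∀ i j : Fin k, (i : ℕ) + 1 = j → F.StrictAncestor (v i) (v j) := by
    intro i j hij
    refine (isAncestor_iff.1 (h.1 i j hij)).resolve_left fun he => ?_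
    have h1 := h.2 i j
    have h2 := h.2 j i
    simp only [he, lt_irrefl, false_iff, not_lt] at h1 h2
    have := π.injective (le_antisymm h2 h1)
    omega
  obtain ⟨i, hi⟩ := i
  obtain ⟨j, hj⟩ := j
  rw [Fin.mk_lt_mk] at hij
  induction j, hij using Nat.le_induction with
  | base => exact step _ _ rfl
  | succ j hij ih => exact (ih (by omega)).trans (step _ _ rfl)

theorem contains_iff_exists_occurs {k : ℕ} (hk : 0 < k) (π : Equiv.Perm (Fin k)) :
    F.Contains ⟨k, π⟩ ↔ ∃ f, F.Occurs (permWord π) (k - 1) f := by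
  constructor
  · rintro ⟨v, hv⟩
    change Fin k → V at v
    -- The truncation only gives values to indices beyond `k - 1`, which `Occurs` ignores.
    refine ⟨fun p => v ⟨min p (k - 1), by omega⟩, fun p q hpq hq => ?_⟩
    have hp' : min p (k - 1) = p := by omega
    have hq' : min q (k - 1) = q := by omega
    simp only [hp', hq']
    rw [permWord_of_lt π (show p < k by omega), permWord_of_lt π (show q < k by omega),
      Fin.val_fin_lt]
    exact ⟨hv.strictAncestor hpq, hv.2 _ _⟩
  · rintro ⟨f, hf⟩
    have key : ∀ i j : Fin k, i < j →
        F.StrictAncestor (f i) (f j) ∧ (f i < f j ↔ π i < π j) := fun i j hij => by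
      have h := hf i j hij (by omega)
      rwa [permWord_of_lt π i.2, permWord_of_lt π j.2, Fin.val_fin_lt] at h
    refine ⟨fun i : Fin k => f i, fun i j hij => ?_, fun i j => ?_⟩
    · exact isAncestor_iff.2 (.inr (key i j (Fin.lt_def.2 (by omega))).1)
    · change f i < f j ↔ π i < π j
      rcases lt_trichotomy i j with h | rfl | h
      · exact (key i j h).2
      · simp
      · obtain ⟨h1, h2⟩ := key j i h
        have h3 : π i ≠ π j := fun he => h.ne' (π.injective he)
        rw [← not_iff_not, not_lt, not_lt, h1.ne.le_iff_lt, h2, h3.symm.le_iff_lt]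

theorem not_contains_pattern213_iff : ¬ F.Contains pattern213 ↔ F.Avoids213 := by
  rw [pattern213, contains_iff_exists_occurs (by norm_num)]
  have h0 : permWord (Equiv.swap (0 : Fin 3) 1) 0 = 1 := by decide
  have h1 : permWord (Equiv.swap (0 : Fin 3) 1) 1 = 0 := by decide
  have h2 : permWord (Equiv.swap (0 : Fin 3) 1) 2 = 2 := by decide
  constructor
  · intro h x y z hxy hyz hyx hxz
    refine h ⟨fun p => if p = 0 then x else if p = 1 then y else z, fun p q hpq hq => ?_⟩
    obtain ⟨rfl, rfl⟩ | ⟨rfl, rfl⟩ | ⟨rfl, rfl⟩ :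
      (p = 0 ∧ q = 1) ∨ (p = 0 ∧ q = 2) ∨ (p = 1 ∧ q = 2) := by omega
    · simp [h0, h1, hxy, hyx.le]
    · simp [h0, h2, hxy.trans hyz, hxz]
    · simp [h1, h2, hyz, hyx.trans hxz]
  · rintro h ⟨f, hf⟩
    obtain ⟨a1, b1⟩ := hf 0 1 (by norm_num) (by norm_num)
    obtain ⟨-, b2⟩ := hf 0 2 (by norm_num) (by norm_num)
    obtain ⟨a3, -⟩ := hf 1 2 (by norm_num) (by norm_num)
    rw [h0, h1] at b1
    rw [h0, h2] at b2
    exact h _ _ _ a1 a3 (lt_of_le_of_ne (not_lt.1 (by simp [b1])) a1.ne.symm) (by simp [b2])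

theorem Occurs.wordAvoids213 {f : ℕ → V} (hF : F.Avoids213) (hf : F.Occurs s L f)
    (hinj : ∀ p q, p < q → q ≤ L → s p ≠ s q) : WordAvoids213 s L := by
  refine ⟨hinj, fun p q t hpq hqt ht h1 h2 => ?_⟩
  have hq := hf p q hpq (by omega)
  refine hF _ _ _ hq.1 (hf q t hqt ht).1 (lt_of_le_of_ne (not_lt.1 ?_) hq.1.ne.symm)
    ((hf p t (by omega) ht).2.2 h2)
  rw [hq.2]
  omega

/-- If two further entries, directly above `s L` in value, are appended to the word
`s 0, …, s L`, then an occurrence amounts to a pair in a block in the corresponding order. -/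
theorem exists_occurs_iff_exists_sameBlock (hF : F.Avoids213)
    (hinj : ∀ p, p < L → s p ≠ s L) {t : ℕ → ℕ}
    (ht : ∀ p, p ≤ L → t p = s p) (h1 : s L < t (L + 1)) (h2 : s L < t (L + 2))
    (hlarge : ∀ p, p < L → s L < s p → t (L + 1) < s p ∧ t (L + 2) < s p) :
    (∃ f, F.Occurs t (L + 2) f) ↔
      ∃ x y, F.StrictAncestor x y ∧ F.SameBlock s L x y ∧ (x < y ↔ t (L + 1) < t (L + 2)) := by
  constructor
  · rintro ⟨f, hf⟩
    have hE : F.Ends s L (f L) := by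
      refine ⟨f, fun p q hpq hq => ?_, rfl⟩
      rw [← ht p (by omega), ← ht q hq]
      exact hf p q hpq (by omega)
    obtain ⟨a1, b1⟩ := hf L (L + 1) (by omega) (by omega)
    obtain ⟨a2, b2⟩ := hf L (L + 2) (by omega) (by omega)
    obtain ⟨a3, b3⟩ := hf (L + 1) (L + 2) (by omega) (by omega)
    rw [ht L le_rfl] at b1 b2
    exact ⟨f (L + 1), f (L + 2), a3, .inr ⟨f L, ⟨hE, a1, b1.2 h1⟩, ⟨hE, a2, b2.2 h2⟩⟩, b3⟩
  · rintro ⟨x, y, hxy, hb, hlt⟩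
    obtain ⟨u, hx, hy⟩ := hb.above_left hxy.ne
    obtain ⟨⟨f, hf, rfl⟩, hux, hltx⟩ := hx
    obtain ⟨-, huy, hlty⟩ := hy
    -- Here `c` is the value of an appended entry: no entry of `s` lies above `s L` and at or below
    -- `c`, so comparing with `c` amounts to comparing with `s L`.
    have key : ∀ {w c}, F.StrictAncestor (f L) w → f L < w → s L < c →
        (∀ p, p < L → s L < s p → c < s p) → ∀ p, p ≤ L →
        F.StrictAncestor (f p) w ∧ (f p < w ↔ s p < c) := by
      intro w c hw hltw hc hcl p hp
      rcases hp.eq_or_lt with rfl | hp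
      · exact ⟨hw, iff_of_true hltw hc⟩
      · refine ⟨(hf p L hp le_rfl).1.trans hw, ?_⟩
        rw [hf.lt_iff_of_above hF hw hltw hp]
        have := hcl p hp
        have := hinj p hp
        omega
    refine ⟨fun p => if p ≤ L then f p else if p = L + 1 then x else y, fun p q hpq hq => ?_⟩
    rcases le_or_gt p L with hp | hp
    · simp only [if_pos hp, ht p hp]
      obtain hq | rfl | rfl : q ≤ L ∨ q = L + 1 ∨ q = L + 2 := by omega
      · simpa only [if_pos hq, ht q hq] using hf p q hpq hq
      · simpa using key hux hltx h1 (fun p hp h => (hlarge p hp h).1) p hp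
      · simpa using key huy hlty h2 (fun p hp h => (hlarge p hp h).2) p hp
    · obtain ⟨rfl, rfl⟩ : p = L + 1 ∧ q = L + 2 := by omega
      simpa using ⟨hxy, hlt⟩

end RootedForest

/-! ### The equivalence. -/

open RootedForest

theorem theorem1p5 (k : ℕ) (hk : 3 ≤ k) (π : Equiv.Perm (Fin k))
    (h₁ : (π ⟨k - 1, by omega⟩ : ℕ) = (π ⟨k - 2, by omega⟩ : ℕ) + 1)
    (h₂ : (π ⟨k - 1, by omega⟩ : ℕ) = (π ⟨k - 3, by omega⟩ : ℕ) + 2) :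
    ForestWilfEquiv {pattern213, ⟨k, π⟩} {pattern213, ⟨k, twist (by omega) π⟩} := by
  obtain ⟨L, rfl⟩ : ∃ L, k = L + 3 := ⟨k - 3, by omega⟩
  have hk2 : 2 ≤ L + 3 := by omega
  have hσ := fun p (hp : p ≤ L) => permWord_twist_of_lt hk2 π (show p < L + 3 - 2 by omega)
  have ht1 : permWord (twist hk2 π) (L + 1) = permWord π (L + 2) := permWord_twist_penultimate hk2 π
  have ht2 : permWord (twist hk2 π) (L + 2) = permWord π (L + 1) := permWord_twist_last hk2 π
  have hne := fun p q (hpq : p < q) (hq : q ≤ L) =>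
    permWord_ne π (show p < L + 3 by omega) (show q < L + 3 by omega) hpq.ne
  have e1 : permWord π (L + 2) = permWord π (L + 1) + 1 := by
    rw [permWord_of_lt π (show L + 2 < L + 3 by omega),
      permWord_of_lt π (show L + 1 < L + 3 by omega)]
    exact h₁
  have e2 : permWord π (L + 2) = permWord π L + 2 := by
    rw [permWord_of_lt π (show L + 2 < L + 3 by omega), permWord_of_lt π (show L < L + 3 by omega)]
    exact h₂
  have hlarge : ∀ p, p < L → permWord π L < permWord π p → permWord π (L + 2) < permWord π p := by
    intro p hp h
    have := permWord_ne π (show p < L + 3 by omega) (show L + 1 < L + 3 by omega) (by omega)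
    have := permWord_ne π (show p < L + 3 by omega) (show L + 2 < L + 3 by omega) (by omega)
    omega
  intro n
  refine Nat.card_congr ?_
  have hav : ∀ (τ : Equiv.Perm (Fin (L + 3))) (F : RootedForest (Fin n)),
      F.Avoids {pattern213, ⟨L + 3, τ⟩} ↔
        F.Avoids213 ∧ ¬ ∃ f, F.Occurs (permWord τ) (L + 2) f := by
    intro τ F
    rw [← not_contains_pattern213_iff]
    have := F.contains_iff_exists_occurs (show 0 < L + 3 by omega) τ
    rw [show L + 2 = L + 3 - 1 from rfl, ← this]
    simp [RootedForest.Avoids]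
  by_cases hs : WordAvoids213 (permWord π) L
  · have hdec : ∀ F : RootedForest (Fin n), F.Avoids {pattern213, ⟨L + 3, π⟩} ↔
        F.Avoids213 ∧ F.BlocksDecrease (permWord π) L := by
      intro F
      rw [hav]
      refine and_congr_right fun hF => ?_
      rw [exists_occurs_iff_exists_sameBlock hF (fun p hp => hne p L hp le_rfl)
        (fun _ _ => rfl) (by omega) (by omega) fun p hp h => by
          have := hlarge p hp h
          omega]
      have : permWord π (L + 1) < permWord π (L + 2) := by omega
      simp only [this, iff_true, not_exists, not_and, not_lt]
      exact forall₄_congr fun x y hxy _ => hxy.ne.symm.le_iff_lt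
    have hinc : ∀ F : RootedForest (Fin n), F.Avoids {pattern213, ⟨L + 3, twist hk2 π⟩} ↔
        F.Avoids213 ∧ F.BlocksIncrease (permWord π) L := by
      intro F
      rw [hav]
      refine and_congr_right fun hF => ?_
      rw [exists_occurs_iff_exists_sameBlock hF (fun p hp => hne p L hp le_rfl)
        hσ (by omega) (by omega) fun p hp h => by
          have := hlarge p hp h
          omega]
      have : ¬ permWord (twist hk2 π) (L + 1) < permWord (twist hk2 π) (L + 2) := by omega
      simp only [this, iff_false, not_exists, not_and, not_not]
      exact Iff.rfl
    exact (Equiv.subtypeEquivRight hdec).trans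
      ((flipEquiv hs).trans (Equiv.subtypeEquivRight hinc).symm)
  -- The common prefix contains 213, so no 213-avoiding forest contains either pattern.
  · have hnot : ∀ F : RootedForest (Fin n), F.Avoids213 → ∀ t : ℕ → ℕ,
        (∀ p, p ≤ L → t p = permWord π p) → ¬ ∃ f, F.Occurs t (L + 2) f := by
      rintro F hF t ht ⟨f, hf⟩
      refine hs (Occurs.wordAvoids213 (f := f) hF (fun p q hpq hq => ?_) hne)
      rw [← ht p (by omega), ← ht q hq]
      exact hf p q hpq (by omega)
    refine Equiv.subtypeEquivRight fun F => ?_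
    rw [hav, hav]
    exact and_congr_right fun hF =>
      iff_of_true (hnot F hF _ fun _ _ => rfl) (hnot F hF _ hσ)
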